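/- Let $K, D, \epsilon > 0$, put $W := DK/(2\pi)$, and let $\ell \in \mathbb{Z}$. Let $J_\ell$ be the Bessel function of the first kind of order $\ell$, and let $T_\ell$ be the integral operator with kernel $J_\ell(\delta k)$, $$(T_\ell f)(\delta) = \int_0^K J_\ell(\delta k)\, f(k)\, k\,dk,$$ from $L^2([0,K], k\,dk)$ to $L^2([0,D], \delta\,d\delta)$. Let $H_\ell$ be the $\epsilon$-rank of $T_\ell$, that is, the number of singular values of $T_\ell$, counted with multiplicity, that are larger than $\epsilon$. Then $H_\ell$ is finite and $$H_\ell \;\le\; \max\Bigl(0,\ \pi e^2 W - \tfrac{|\ell|}{2},\ \log\bigl(\tfrac{2\pi W}{\epsilon}\bigr) + \tfrac32 - \tfrac{|\ell|}{2}\Bigr).$$ -/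

import Mathlib

open MeasureTheory

noncomputable section

/-- The `m`-th term of the power series of the Bessel function `J_n` at `x`, for `n : ℕ`. -/
def besselTerm (n : ℕ) (x : ℝ) (m : ℕ) : ℝ :=
  (-1) ^ m / (m.factorial * (m + n).factorial : ℝ) * (x / 2) ^ (2 * m + n)

/-- The Bessel function of the first kind `J_ℓ` of integer order `ℓ`: for `n ≥ 0`,
`J_n(x) = ∑ₘ (-1)^m / (m! (m+n)!) (x/2)^(2m+n)` and `J_{-n}(x) = (-1)^n J_n(x)`. -/
def besselJ (ℓ : ℤ) (x : ℝ) : ℝ :=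
  (if ℓ < 0 then (-1) ^ ℓ.natAbs else 1) * ∑' m : ℕ, besselTerm ℓ.natAbs x m

/-- The measure `r dr` on `[0, a]`. -/
def radialMeasure (a : ℝ) : Measure ℝ :=
  (volume.restrict (Set.Icc 0 a)).withDensity (fun r => ENNReal.ofReal r)

theorem abs_besselTerm_le (n : ℕ) {x R : ℝ} (hx : |x| ≤ R) (m : ℕ) :
    ‖besselTerm n x m‖ ≤ (R / 2) ^ n * (((R / 2) ^ 2) ^ m / (m.factorial : ℝ)) := by
  have hR : 0 ≤ R := (abs_nonneg x).trans hx
  have h1 : (1 : ℝ) ≤ ((m + n).factorial : ℝ) := by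
    exact_mod_cast Nat.factorial_pos (m + n)
  have h2 : (0 : ℝ) < (m.factorial : ℝ) := by exact_mod_cast Nat.factorial_pos m
  have h3 : |x| / 2 ≤ R / 2 := by linarith
  have h4 : (m.factorial : ℝ) ≤ m.factorial * (m + n).factorial :=
    le_mul_of_one_le_right h2.le h1
  have h5 : (|x| / 2) ^ (2 * m + n) ≤ (R / 2) ^ (2 * m + n) :=
    pow_le_pow_left₀ (by positivity) h3 _
  calc ‖besselTerm n x m‖
      = 1 / (m.factorial * (m + n).factorial : ℝ) * (|x| / 2) ^ (2 * m + n) := by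
        simp [besselTerm]
    _ ≤ 1 / (m.factorial : ℝ) * (R / 2) ^ (2 * m + n) := by
        gcongr
    _ = _ := by
        rw [pow_add, pow_mul]; ring

theorem summable_besselTerm_bound (n : ℕ) (R : ℝ) :
    Summable fun m : ℕ => (R / 2) ^ n * (((R / 2) ^ 2) ^ m / (m.factorial : ℝ)) :=
  (Real.summable_pow_div_factorial _).mul_left _

/-- The Bessel series converges everywhere. -/
theorem summable_besselTerm (n : ℕ) (x : ℝ) : Summable (besselTerm n x) :=
  Summable.of_norm_bounded (summable_besselTerm_bound n |x|)
    (fun m => abs_besselTerm_le n le_rfl m)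

theorem continuous_besselJ (ℓ : ℤ) : Continuous (besselJ ℓ) := by
  unfold besselJ
  refine continuous_const.mul ?_
  rw [continuous_iff_continuousAt]
  intro x
  have h : ContinuousOn (fun x => ∑' m : ℕ, besselTerm ℓ.natAbs x m)
      (Set.Icc (-(|x| + 1)) (|x| + 1)) := by
    refine continuousOn_tsum (fun m => ?_) (summable_besselTerm_bound ℓ.natAbs (|x| + 1))
      (fun m y hy => abs_besselTerm_le _ (abs_le.2 hy) m)
    unfold besselTerm
    fun_prop
  refine h.continuousAt (Icc_mem_nhds ?_ ?_)
  · linarith [neg_abs_le x]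
  · linarith [le_abs_self x]

instance isFiniteMeasure_radialMeasure (a : ℝ) : IsFiniteMeasure (radialMeasure a) := by
  refine isFiniteMeasure_withDensity_ofReal ?_
  exact (continuous_id.continuousOn.integrableOn_Icc (μ := volume)).2

theorem ae_mem_radialMeasure (a : ℝ) : ∀ᵐ r ∂radialMeasure a, r ∈ Set.Icc 0 a :=
  (withDensity_absolutelyContinuous _ _).ae_le (ae_restrict_mem measurableSet_Icc)

theorem exists_besselJ_bound (ℓ : ℤ) (D K : ℝ) :
    ∃ C : ℝ, 0 ≤ C ∧ ∀ δ ∈ Set.Icc 0 D, ∀ k ∈ Set.Icc 0 K, |besselJ ℓ (δ * k)| ≤ C := by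
  obtain ⟨C, hC⟩ := (isCompact_Icc (a := (0 : ℝ)) (b := D * K)).exists_bound_of_continuousOn
    (continuous_besselJ ℓ).continuousOn
  refine ⟨max C 0, le_max_right _ _, fun δ hδ k hk => ?_⟩
  refine (hC (δ * k) ⟨mul_nonneg hδ.1 hk.1, ?_⟩).trans (le_max_left _ _)
  exact mul_le_mul hδ.2 hk.2 hk.1 (hδ.1.trans hδ.2)

section Operator

variable {𝕜 : Type*} [RCLike 𝕜]

/-- The function `δ ↦ ∫_0^K J_ℓ(δ k) f(k) k dk`. -/
def modalIntegral (ℓ : ℤ) (K : ℝ) (f : ℝ → 𝕜) (δ : ℝ) : 𝕜 :=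
  ∫ k, (besselJ ℓ (δ * k) : 𝕜) * f k ∂radialMeasure K

theorem integrable_of_Lp {K : ℝ} (f : Lp 𝕜 2 (radialMeasure K)) :
    Integrable f (radialMeasure K) :=
  (Lp.memLp f).integrable (by norm_num)

theorem integrable_modal (ℓ : ℤ) {K : ℝ} (f : Lp 𝕜 2 (radialMeasure K)) (δ : ℝ) :
    Integrable (fun k => (besselJ ℓ (δ * k) : 𝕜) * f k) (radialMeasure K) := by
  have hc : Continuous fun k => besselJ ℓ (δ * k) :=
    (continuous_besselJ ℓ).comp (continuous_const.mul continuous_id)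
  obtain ⟨C, hC⟩ := (isCompact_Icc (a := (0 : ℝ)) (b := K)).exists_bound_of_continuousOn
    hc.continuousOn
  refine (integrable_of_Lp f).bdd_mul (c := C) ?_ ?_
  · exact (RCLike.continuous_ofReal.comp hc).aestronglyMeasurable
  · filter_upwards [ae_mem_radialMeasure K] with k hk
    simpa using hC k hk

theorem norm_modalIntegral_le (ℓ : ℤ) (D K : ℝ) :
    ∃ C : ℝ, 0 ≤ C ∧ ∀ f : Lp 𝕜 2 (radialMeasure K),
      ∀ᵐ δ ∂radialMeasure D, ‖modalIntegral ℓ K f δ‖ ≤ C * ‖f‖ := by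
  obtain ⟨C, hC0, hC⟩ := exists_besselJ_bound ℓ D K
  set A : ℝ := ((radialMeasure K Set.univ) ^ (1 / (1 : ENNReal).toReal - 1 / (2 : ENNReal).toReal)).toReal
  refine ⟨C * A, mul_nonneg hC0 ENNReal.toReal_nonneg, fun f => ?_⟩
  filter_upwards [ae_mem_radialMeasure D] with δ hδ
  have h1 : ‖modalIntegral ℓ K f δ‖ ≤ ∫ k, C * ‖f k‖ ∂radialMeasure K := by
    refine norm_integral_le_of_norm_le ((integrable_of_Lp f).norm.const_mul C) ?_
    filter_upwards [ae_mem_radialMeasure K] with k hk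
    rw [norm_mul, RCLike.norm_ofReal]
    exact mul_le_mul_of_nonneg_right (hC δ hδ k hk) (norm_nonneg _)
  have h2 : ∫ k, ‖f k‖ ∂radialMeasure K ≤ ‖f‖ * A := by
    have h3 := eLpNorm_le_eLpNorm_mul_rpow_measure_univ (μ := radialMeasure K) (f := f)
      (p := 1) (q := 2) (by norm_num) (Lp.aestronglyMeasurable f)
    rw [integral_norm_eq_lintegral_enorm (Lp.aestronglyMeasurable f),
      ← eLpNorm_one_eq_lintegral_enorm, Lp.norm_def, ← ENNReal.toReal_mul]
    refine ENNReal.toReal_mono (ENNReal.mul_ne_top (Lp.eLpNorm_ne_top f) ?_) h3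
    exact ENNReal.rpow_ne_top_of_nonneg (by norm_num) (measure_ne_top _ _)
  rw [integral_const_mul] at h1
  calc _ ≤ _ := h1
    _ ≤ C * (‖f‖ * A) := mul_le_mul_of_nonneg_left h2 hC0
    _ = _ := by ring

theorem memLp_modalIntegral (ℓ : ℤ) (D : ℝ) {K : ℝ} (f : Lp 𝕜 2 (radialMeasure K)) :
    MemLp (modalIntegral ℓ K f) 2 (radialMeasure D) := by
  obtain ⟨C, -, hC⟩ := norm_modalIntegral_le (𝕜 := 𝕜) ℓ D K
  refine MemLp.of_bound ?_ (C * ‖f‖) (hC f)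
  have hJ : Continuous fun p : ℝ × ℝ => (besselJ ℓ (p.1 * p.2) : 𝕜) :=
    RCLike.continuous_ofReal.comp ((continuous_besselJ ℓ).comp (continuous_fst.mul continuous_snd))
  have h : StronglyMeasurable fun p : ℝ × ℝ => (besselJ ℓ (p.1 * p.2) : 𝕜) * f p.2 :=
    hJ.stronglyMeasurable.mul ((Lp.stronglyMeasurable f).comp_measurable measurable_snd)
  exact h.integral_prod_right'.aestronglyMeasurable

variable (𝕜) in
/-- The integral operator `(T f)(δ) = ∫_0^K J_ℓ(δ k) f(k) k dk` with the modal kernel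
`J_ℓ(δ k)`, from `L²([0, K], k dk)` to `L²([0, D], δ dδ)`. -/
def modalOperator (ℓ : ℤ) (K D : ℝ) :
    Lp 𝕜 2 (radialMeasure K) →L[𝕜] Lp 𝕜 2 (radialMeasure D) :=
  LinearMap.mkContinuousOfExistsBound
    { toFun := fun f => (memLp_modalIntegral ℓ D f).toLp (modalIntegral ℓ K f)
      map_add' := fun f g => by
        rw [← MemLp.toLp_add]
        refine MemLp.toLp_congr _ _ (Filter.Eventually.of_forall fun δ => ?_)
        simp only [modalIntegral, Pi.add_apply]
        rw [← integral_add (integrable_modal ℓ f δ) (integrable_modal ℓ g δ)]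
        refine integral_congr_ae ?_
        filter_upwards [Lp.coeFn_add f g] with k hk
        rw [hk, Pi.add_apply, mul_add]
      map_smul' := fun c f => by
        rw [RingHom.id_apply, ← MemLp.toLp_const_smul]
        refine MemLp.toLp_congr _ _ (Filter.Eventually.of_forall fun δ => ?_)
        simp only [modalIntegral, Pi.smul_apply]
        rw [smul_eq_mul, ← integral_const_mul]
        refine integral_congr_ae ?_
        filter_upwards [Lp.coeFn_smul c f] with k hk
        rw [hk, Pi.smul_apply, smul_eq_mul]
        ring }
    (by
      obtain ⟨C, hC0, hC⟩ := norm_modalIntegral_le (𝕜 := 𝕜) ℓ D K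
      refine ⟨(measureUnivNNReal (radialMeasure D) : ℝ) ^ (2 : ENNReal).toReal⁻¹ * C, fun f => ?_⟩
      have h := Lp.norm_le_of_ae_bound (f := (memLp_modalIntegral ℓ D f).toLp
        (modalIntegral ℓ K f)) (mul_nonneg hC0 (norm_nonneg f)) (by
          filter_upwards [hC f, (memLp_modalIntegral ℓ D f).coeFn_toLp] with δ h1 h2
          rwa [h2])
      exact h.trans_eq (mul_assoc _ _ _).symm)

/-- The operator is the integral operator with kernel `J_ℓ(δ k)`. -/
theorem modalOperator_apply (ℓ : ℤ) (K D : ℝ) (f : Lp 𝕜 2 (radialMeasure K)) :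
    modalOperator 𝕜 ℓ K D f =ᵐ[radialMeasure D]
      fun δ => ∫ k, (besselJ ℓ (δ * k) : 𝕜) * f k ∂radialMeasure K :=
  (memLp_modalIntegral ℓ D f).coeFn_toLp

end Operator

section SingularValues

variable {𝕜 E F : Type*} [RCLike 𝕜]
  [NormedAddCommGroup E] [InnerProductSpace 𝕜 E] [CompleteSpace E]
  [NormedAddCommGroup F] [InnerProductSpace 𝕜 F] [CompleteSpace F]

/-- The multiplicity of `s > 0` as a singular value of the (compact) operator `T`: the dimension
of the eigenspace of `T* T` for the eigenvalue `s ^ 2` (it is `0` if `s` is not a singular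
value). -/
def singularValueMultiplicity (T : E →L[𝕜] F) (s : ℝ) : Cardinal :=
  Module.rank 𝕜
    (Module.End.eigenspace ((ContinuousLinearMap.adjoint T ∘L T : E →L[𝕜] E) : E →ₗ[𝕜] E)
      ((s ^ 2 : ℝ) : 𝕜))

/-- The `ε`-rank (for `ε > 0`) of the (compact) operator `T`: the number of singular values of `T`
that are larger than `ε`, counted with multiplicity. -/
def epsilonRank (T : E →L[𝕜] F) (ε : ℝ) : Cardinal :=
  Cardinal.sum fun s : Set.Ioi ε => singularValueMultiplicity T s

end SingularValues

end

/-! An operator with norm at most `ε` on the kernel of a map to `𝕜 ^ N` has at most `N` singular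
values above `ε` (`epsilonRank_le_of_norm_le_on_ker`). Here the map takes `N` moments of `f`: the
`N`-term Taylor polynomial of `J_ℓ (δ k)` is a sum of `N` products of a function of `δ` and a power
of `k`, so vanishing moments leave only the Taylor remainder in the kernel.

Put `R = D K = 2πW` and `p = 2 N + |ℓ|`, the degree of the first omitted term. If `e² R ≤ p + 2`,
the remainder is at most `2 (p + 1) e^(-p)` on `[0, R]`. Cauchy–Schwarz in both variables
contributes `R / 2`, so the norm is at most `R (p + 1) e^(-p) ≤ R e^((1 - p) / 2)`. Taking `N` to be
the floor of the claimed bound ensures both `e² R ≤ p + 2` and `R e^((1 - p) / 2) ≤ ε`. -/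

/-! ### Counting singular values. -/

section SingularValueCount

variable {𝕜 E F : Type*} [RCLike 𝕜]
  [NormedAddCommGroup E] [InnerProductSpace 𝕜 E] [CompleteSpace E]
  [NormedAddCommGroup F] [InnerProductSpace 𝕜 F] [CompleteSpace F]

/-- On a finite sum of eigenvectors `x s` of `T* T` for the eigenvalues `s ^ 2`, the quadratic form
`‖T x‖ ^ 2` is diagonal. -/
theorem norm_sq_apply_sum_eigenvectors (T : E →L[𝕜] F) {ε : ℝ} (hε : 0 < ε)
    (x : ∀ s : Set.Ioi ε, Module.End.eigenspace
      ((ContinuousLinearMap.adjoint T ∘L T : E →L[𝕜] E) : E →ₗ[𝕜] E) (((s : ℝ) ^ 2 : ℝ) : 𝕜))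
    (t : Finset (Set.Ioi ε)) :
    ‖T (∑ s ∈ t, (x s : E))‖ ^ 2 = ∑ s ∈ t, (s : ℝ) ^ 2 * ‖x s‖ ^ 2 ∧
      ‖∑ s ∈ t, (x s : E)‖ ^ 2 = ∑ s ∈ t, ‖x s‖ ^ 2 := by
  have hsymm := (ContinuousLinearMap.isSelfAdjoint_iff_isSymmetric.1
    (ContinuousLinearMap.isPositive_adjoint_comp_self T).isSelfAdjoint)
  have hinj : Function.Injective fun s : Set.Ioi ε => (((s : ℝ) ^ 2 : ℝ) : 𝕜) := by
    intro a b hab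
    have h1 : (a : ℝ) ^ 2 = (b : ℝ) ^ 2 := RCLike.ofReal_injective hab
    exact Subtype.ext ((pow_left_inj₀ (hε.trans a.2).le (hε.trans b.2).le two_ne_zero).1 h1)
  have hV := hsymm.orthogonalFamily_eigenspaces.comp hinj
  refine ⟨?_, hV.norm_sum x t⟩
  have h1 : (ContinuousLinearMap.adjoint T ∘L T) (∑ s ∈ t, (x s : E)) =
      ∑ s ∈ t, (((((s : ℝ) ^ 2 : ℝ) : 𝕜) • x s : Module.End.eigenspace _ _) : E) := by
    rw [map_sum]
    exact Finset.sum_congr rfl fun s _ => Module.End.mem_eigenspace_iff.1 (x s).2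
  rw [T.apply_norm_sq_eq_inner_adjoint_left, h1]
  refine (congrArg RCLike.re (hV.inner_sum (fun s => (((s : ℝ) ^ 2 : ℝ) : 𝕜) • x s) x t)).trans ?_
  rw [map_sum]
  refine Finset.sum_congr rfl fun s _ => ?_
  rw [inner_smul_left, RCLike.conj_ofReal, RCLike.re_ofReal_mul, inner_self_eq_norm_sq]

end SingularValueCount

universe u

/-- If `‖T x‖ ≤ ε ‖x‖` on the kernel of a linear map to an `N`-dimensional space, then `T` has at
most `N` singular values larger than `ε`. -/
theorem epsilonRank_le_of_norm_le_on_ker {𝕜 E F : Type u} [RCLike 𝕜]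
    [NormedAddCommGroup E] [InnerProductSpace 𝕜 E] [CompleteSpace E]
    [NormedAddCommGroup F] [InnerProductSpace 𝕜 F] [CompleteSpace F]
    (T : E →L[𝕜] F) {ε : ℝ} (hε : 0 < ε) {N : ℕ} (A : E →ₗ[𝕜] (Fin N → 𝕜))
    (hA : ∀ x, A x = 0 → ‖T x‖ ≤ ε * ‖x‖) : epsilonRank T ε ≤ N := by
  classical
  set V : Set.Ioi ε → Submodule 𝕜 E := fun s => Module.End.eigenspace
      ((ContinuousLinearMap.adjoint T ∘L T : E →L[𝕜] E) : E →ₗ[𝕜] E) (((s : ℝ) ^ 2 : ℝ) : 𝕜)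
  have hrank : epsilonRank T ε = Module.rank 𝕜 (DirectSum (Set.Ioi ε) fun s => V s) :=
    (rank_directSum 𝕜 fun s => V s).symm
  rw [hrank]
  -- A nonzero finite sum `x` of these eigenvectors has `‖T x‖ > ε ‖x‖`, so `A` cannot kill it.
  have hinj : Function.Injective (A ∘ₗ DirectSum.coeLinearMap V) := by
    rw [← LinearMap.ker_eq_bot, LinearMap.ker_eq_bot']
    intro x hx
    have hcoe : DirectSum.coeLinearMap V x = ∑ s ∈ DFinsupp.support x, (x s : E) := by
      rw [DirectSum.coeLinearMap_eq_dfinsuppSum]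
      rfl
    have h1 := hA _ hx
    obtain ⟨h2, h3⟩ := norm_sq_apply_sum_eigenvectors T hε (fun s => x s) (DFinsupp.support x)
    rw [hcoe] at h1
    have h4 := pow_le_pow_left₀ (norm_nonneg _) h1 2
    rw [mul_pow, h2, h3, Finset.mul_sum] at h4
    ext s
    by_contra hs
    have hs0 : x s ≠ 0 := fun h => hs (by rw [h]; rfl)
    refine h4.not_gt (Finset.sum_lt_sum (fun a _ => ?_) ⟨s, by simpa using hs0, ?_⟩)
    · have := a.2.out
      gcongr
    · have := s.2.out
      have := norm_pos_iff.2 hs0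
      gcongr
  have := LinearMap.rank_le_of_injective _ hinj
  simpa using this

/-! ### The Taylor remainder of the Bessel function. -/

/-- The quotient of the factorials is a binomial coefficient. The power of 2 will cancel the one in
`(x / 2) ^ (2 m + n)`. -/
theorem factorial_add_le_two_pow_mul (m n : ℕ) :
    ((2 * m + n).factorial : ℝ) ≤ 2 ^ (2 * m + n) * (m.factorial * (m + n).factorial) := by
  have h := Nat.add_choose_mul_factorial_mul_factorial m (m + n)
  have h2 := Nat.choose_le_two_pow (m + (m + n)) (m + n)
  rw [show 2 * m + n = m + (m + n) by ring]
  rw [← h, mul_assoc]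
  push_cast
  gcongr
  exact_mod_cast h2

theorem abs_besselTerm_le_pow_div_factorial (n : ℕ) {x R : ℝ} (hx : |x| ≤ R) (m : ℕ) :
    ‖besselTerm n x m‖ ≤ R ^ (2 * m + n) / ((2 * m + n).factorial : ℝ) := by
  have h1 : (0 : ℝ) < m.factorial * (m + n).factorial := by positivity
  have h2 : (0 : ℝ) < (2 * m + n).factorial := by positivity
  calc ‖besselTerm n x m‖
      = |x| ^ (2 * m + n) / (2 ^ (2 * m + n) * (m.factorial * (m + n).factorial)) := by
        simp only [besselTerm, norm_mul, norm_div, norm_pow, norm_neg, norm_one, one_pow,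
          Real.norm_eq_abs, Nat.abs_cast, Nat.abs_ofNat, div_pow]
        field_simp
    _ ≤ R ^ (2 * m + n) / ((2 * m + n).factorial : ℝ) := by
        have := factorial_add_le_two_pow_mul m n
        have hR : 0 ≤ R := (abs_nonneg x).trans hx
        gcongr

theorem pow_div_factorial_le_geometric {R : ℝ} (hR : 0 ≤ R) {p : ℕ}
    (hp : 4 * R ≤ p + 2) (j : ℕ) :
    R ^ (p + 2 * j) / ((p + 2 * j).factorial : ℝ) ≤
      R ^ p / (p.factorial : ℝ) * (1 / 2) ^ j := by
  induction j with
  | zero => simp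
  | succ j ih =>
    set q := p + 2 * j with hq
    have hqp : (p : ℝ) ≤ q := by exact_mod_cast Nat.le_add_right _ _
    have hp0 : (0 : ℝ) ≤ p := p.cast_nonneg
    have hf : (0 : ℝ) < q.factorial := by positivity
    rw [show p + 2 * (j + 1) = q + 1 + 1 by omega, Nat.factorial_succ, Nat.factorial_succ]
    -- The ratio of consecutive terms: `4 R ≤ q + 2 ≤ 2 (q + 1)`.
    have h1 : R ^ 2 / ((q + 2) * (q + 1) : ℝ) ≤ 1 / 2 := by
      rw [div_le_iff₀ (by positivity)]
      nlinarith
    calc R ^ (q + 1 + 1) / (((q + 1 + 1) * ((q + 1) * q.factorial) : ℕ) : ℝ)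
        = R ^ q / (q.factorial : ℝ) * (R ^ 2 / ((q + 2) * (q + 1) : ℝ)) := by
          push_cast
          rw [show (q : ℝ) + 1 + 1 = q + 2 by ring]
          field_simp
          ring
      _ ≤ R ^ p / (p.factorial : ℝ) * (1 / 2) ^ j * (1 / 2) := by gcongr
      _ = _ := by ring

/-- A weak Stirling bound, by induction from `(1 + 1 / (p + 2)) ^ (p + 1) ≤ e`. -/
theorem add_two_pow_le_exp_mul_factorial (p : ℕ) :
    ((p : ℝ) + 2) ^ p ≤ Real.exp p * ((p + 1).factorial : ℝ) := by
  induction p with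
  | zero => simp
  | succ p ih =>
    have h1 : ((p : ℝ) + 3) ^ (p + 1) ≤ ((p : ℝ) + 2) ^ (p + 1) * Real.exp 1 := by
      have h2 : ((p : ℝ) + 3) ≤ (p + 2) * Real.exp (1 / (p + 2)) := by
        have := Real.add_one_le_exp (1 / ((p : ℝ) + 2))
        calc (p : ℝ) + 3 = (p + 2) * (1 / (p + 2) + 1) := by field_simp; ring
          _ ≤ _ := by gcongr
      calc ((p : ℝ) + 3) ^ (p + 1) ≤ ((p + 2) * Real.exp (1 / (p + 2))) ^ (p + 1) := by gcongr
        _ = ((p : ℝ) + 2) ^ (p + 1) * Real.exp ((p + 1) / (p + 2)) := by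
          rw [mul_pow, ← Real.exp_nat_mul]; congr 2; push_cast; ring
        _ ≤ _ := by
          gcongr
          rw [div_le_one (by positivity)]; linarith
    rw [Nat.factorial_succ (p + 1)]
    push_cast
    calc ((p : ℝ) + 1 + 2) ^ (p + 1) = (p + 3 : ℝ) ^ (p + 1) := by ring
      _ ≤ ((p : ℝ) + 2) ^ (p + 1) * Real.exp 1 := h1
      _ = ((p : ℝ) + 2) ^ p * ((p + 2) * Real.exp 1) := by ring
      _ ≤ Real.exp p * ((p + 1).factorial : ℝ) * ((p + 2) * Real.exp 1) := by gcongr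
      _ = _ := by rw [Real.exp_add]; ring

/-- Of the factor `e²`, one `e` pays for Stirling and the other leaves the decay `e^(-p)`. -/
theorem pow_div_factorial_le_exp {R : ℝ} (hR : 0 ≤ R) {p : ℕ}
    (hp : Real.exp 2 * R ≤ p + 2) :
    R ^ p / (p.factorial : ℝ) ≤ (p + 1) * Real.exp (-p) := by
  have hf : (0 : ℝ) < p.factorial := by positivity
  rw [div_le_iff₀ hf]
  have h1 : R ≤ (p + 2) * Real.exp (-2) := by
    rw [Real.exp_neg, ← div_eq_mul_inv, le_div_iff₀ (Real.exp_pos _)]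
    linarith
  calc R ^ p ≤ ((p + 2) * Real.exp (-2)) ^ p := by gcongr
    _ = ((p : ℝ) + 2) ^ p * Real.exp (-p + -p) := by
      rw [mul_pow, ← Real.exp_nat_mul]; congr 2; ring
    _ ≤ Real.exp p * ((p + 1).factorial : ℝ) * Real.exp (-p + -p) := by
      gcongr
      exact add_two_pow_le_exp_mul_factorial p
    _ = (p + 1) * Real.exp (-p) * p.factorial := by
      rw [Nat.factorial_succ, Real.exp_add, Real.exp_neg]
      push_cast
      field_simp

/-- The Taylor polynomial of `J_ℓ` with `N` terms. -/
noncomputable def besselPartial (ℓ : ℤ) (N : ℕ) (x : ℝ) : ℝ :=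
  (if ℓ < 0 then (-1) ^ ℓ.natAbs else 1) * ∑ m ∈ Finset.range N, besselTerm ℓ.natAbs x m

theorem abs_besselJ_sub_besselPartial_le (ℓ : ℤ) (N : ℕ) {x R : ℝ} (hx : |x| ≤ R)
    (hR : Real.exp 2 * R ≤ (2 * N + ℓ.natAbs : ℕ) + 2) :
    |besselJ ℓ x - besselPartial ℓ N x| ≤
      2 * (((2 * N + ℓ.natAbs : ℕ) + 1) * Real.exp (-(2 * N + ℓ.natAbs : ℕ))) := by
  have hR0 : 0 ≤ R := (abs_nonneg x).trans hx
  set p := 2 * N + ℓ.natAbs with hp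
  have h4 : 4 * R ≤ p + 2 := by
    refine le_trans ?_ hR
    gcongr
    have := Real.exp_one_gt_d9
    rw [show (2 : ℝ) = 1 + 1 by norm_num, Real.exp_add]
    nlinarith
  have hsign : |(if ℓ < 0 then (-1) ^ ℓ.natAbs else 1 : ℝ)| = 1 := by
    split_ifs <;> simp
  rw [besselJ, besselPartial, ← mul_sub, abs_mul, hsign, one_mul,
    ← (summable_besselTerm ℓ.natAbs x).sum_add_tsum_nat_add N, add_sub_cancel_left]
  have h5 := tsum_of_norm_bounded (f := fun j => besselTerm ℓ.natAbs x (j + N))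
    (hasSum_geometric_two.mul_left (R ^ p / (p.factorial : ℝ))) fun j => by
      refine (abs_besselTerm_le_pow_div_factorial _ hx _).trans ?_
      rw [show 2 * (j + N) + ℓ.natAbs = p + 2 * j by omega]
      exact pow_div_factorial_le_geometric hR0 h4 j
  rw [Real.norm_eq_abs] at h5
  refine h5.trans ?_
  rw [mul_comm]
  gcongr
  exact pow_div_factorial_le_exp hR0 hR

/-- Half of the decay absorbs the factor `p + 1`; the remaining `p / 2 = N + |ℓ| / 2` is the source
of `|ℓ| / 2` in the final bound. -/
theorem add_one_mul_exp_neg_le (p : ℝ) :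
    (p + 1) * Real.exp (-p) ≤ Real.exp (1 / 2 - p / 2) := by
  have h1 : p + 1 ≤ Real.exp ((p + 1) / 2) := by
    have h2 := Real.add_one_le_exp ((p - 1) / 2)
    have h3 : Real.exp ((p + 1) / 2) = Real.exp ((p - 1) / 2) * Real.exp 1 := by
      rw [← Real.exp_add]; congr 1; ring
    have h4 := Real.exp_one_gt_d9
    have h5 := Real.exp_pos ((p - 1) / 2)
    nlinarith
  calc _ ≤ Real.exp ((p + 1) / 2) * Real.exp (-p) := by gcongr
    _ = _ := by rw [← Real.exp_add]; congr 1; ring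

/-! ### Moments, and the operator norm where they vanish. -/

theorem radialMeasure_univ {a : ℝ} (ha : 0 ≤ a) :
    radialMeasure a Set.univ = ENNReal.ofReal (a ^ 2 / 2) := by
  rw [radialMeasure, withDensity_apply _ MeasurableSet.univ, Measure.restrict_univ,
    ← ofReal_integral_eq_lintegral_ofReal]
  · rw [integral_Icc_eq_integral_Ioc, ← intervalIntegral.integral_of_le ha, integral_id]
    simp
  · exact continuous_id.continuousOn.integrableOn_Icc
  · filter_upwards [ae_restrict_mem measurableSet_Icc] with r hr using hr.1

/-- Cauchy–Schwarz against the constant 1, whose squared norm is the total mass `K ^ 2 / 2`. -/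
theorem integral_norm_le_of_Lp {𝕜 : Type*} [RCLike 𝕜] {K : ℝ} (hK : 0 ≤ K)
    (f : Lp 𝕜 2 (radialMeasure K)) :
    ∫ k, ‖f k‖ ∂radialMeasure K ≤ √(K ^ 2 / 2) * ‖f‖ := by
  have h3 := eLpNorm_le_eLpNorm_mul_rpow_measure_univ (μ := radialMeasure K) (f := f)
    (p := 1) (q := 2) (by norm_num) (Lp.aestronglyMeasurable f)
  have hA : ((radialMeasure K Set.univ) ^
      (1 / (1 : ENNReal).toReal - 1 / (2 : ENNReal).toReal)).toReal = √(K ^ 2 / 2) := by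
    rw [radialMeasure_univ hK, ← ENNReal.toReal_rpow, ENNReal.toReal_ofReal (by positivity),
      Real.sqrt_eq_rpow]
    norm_num
  rw [integral_norm_eq_lintegral_enorm (Lp.aestronglyMeasurable f),
    ← eLpNorm_one_eq_lintegral_enorm, Lp.norm_def, ← hA, mul_comm, ← ENNReal.toReal_mul]
  refine ENNReal.toReal_mono (ENNReal.mul_ne_top (Lp.eLpNorm_ne_top f) ?_) h3
  exact ENNReal.rpow_ne_top_of_nonneg (by norm_num) (measure_ne_top _ _)

theorem integrable_pow_mul {𝕜 : Type*} [RCLike 𝕜] {K : ℝ} (f : Lp 𝕜 2 (radialMeasure K))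
    (q : ℕ) : Integrable (fun k => ((k ^ q : ℝ) : 𝕜) * f k) (radialMeasure K) := by
  have hc : Continuous fun k : ℝ => k ^ q := by fun_prop
  refine (integrable_of_Lp f).bdd_mul (c := K ^ q) ?_ ?_
  · exact (RCLike.continuous_ofReal.comp hc).aestronglyMeasurable
  · filter_upwards [ae_mem_radialMeasure K] with k hk
    rw [RCLike.norm_ofReal, abs_pow, abs_of_nonneg hk.1]
    exact pow_le_pow_left₀ hk.1 hk.2 q

/-- The moments `∫ k ^ (2 m + n) f(k) k dk` for `m < N`. -/
noncomputable def radialMoments (𝕜 : Type*) [RCLike 𝕜] (K : ℝ) (n N : ℕ) :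
    Lp 𝕜 2 (radialMeasure K) →ₗ[𝕜] (Fin N → 𝕜) where
  toFun f m := ∫ k, ((k ^ (2 * (m : ℕ) + n) : ℝ) : 𝕜) * f k ∂radialMeasure K
  map_add' f g := by
    ext m
    rw [Pi.add_apply, ← integral_add (integrable_pow_mul f _) (integrable_pow_mul g _)]
    refine integral_congr_ae ?_
    filter_upwards [Lp.coeFn_add f g] with k hk
    rw [hk, Pi.add_apply, mul_add]
  map_smul' c f := by
    ext m
    rw [RingHom.id_apply, Pi.smul_apply, smul_eq_mul, ← integral_const_mul]
    refine integral_congr_ae ?_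
    filter_upwards [Lp.coeFn_smul c f] with k hk
    rw [hk, Pi.smul_apply, smul_eq_mul]
    ring

section

variable {𝕜 : Type*} [RCLike 𝕜]

theorem besselPartial_mul_eq_sum (ℓ : ℤ) (N : ℕ) (δ k : ℝ) (z : 𝕜) :
    (besselPartial ℓ N (δ * k) : 𝕜) * z = ∑ m ∈ Finset.range N,
      (((if ℓ < 0 then (-1) ^ ℓ.natAbs else 1) * besselTerm ℓ.natAbs δ m : ℝ) : 𝕜) *
        (((k ^ (2 * m + ℓ.natAbs) : ℝ) : 𝕜) * z) := by
  rw [besselPartial, Finset.mul_sum]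
  push_cast
  rw [Finset.sum_mul]
  refine Finset.sum_congr rfl fun m _ => ?_
  simp only [besselTerm]
  push_cast
  rw [mul_div_right_comm, mul_pow]
  ring

theorem integrable_besselPartial_mul (ℓ : ℤ) (N : ℕ) {K : ℝ} (f : Lp 𝕜 2 (radialMeasure K))
    (δ : ℝ) : Integrable (fun k => (besselPartial ℓ N (δ * k) : 𝕜) * f k) (radialMeasure K) := by
  simp only [besselPartial_mul_eq_sum]
  exact integrable_finsetSum _ fun m _ => (integrable_pow_mul f _).const_mul _

theorem integral_besselPartial_mul_eq_zero (ℓ : ℤ) (N : ℕ) {K : ℝ}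
    (f : Lp 𝕜 2 (radialMeasure K)) (hf : radialMoments 𝕜 K ℓ.natAbs N f = 0) (δ : ℝ) :
    ∫ k, (besselPartial ℓ N (δ * k) : 𝕜) * f k ∂radialMeasure K = 0 := by
  simp only [besselPartial_mul_eq_sum]
  rw [integral_finsetSum _ fun m _ => (integrable_pow_mul f _).const_mul _]
  refine Finset.sum_eq_zero fun m hm => ?_
  rw [integral_const_mul]
  have h := congrFun hf ⟨m, Finset.mem_range.1 hm⟩
  simp only [radialMoments, LinearMap.coe_mk, AddHom.coe_mk, Pi.zero_apply] at h
  rw [h, mul_zero]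

/-- If `J_ℓ` is within `C` of its Taylor polynomial on `[0, D K]`, the modal operator has norm at
most `C D K / 2` on the functions with vanishing moments. -/
theorem norm_modalOperator_le_of_radialMoments_eq_zero (ℓ : ℤ) (N : ℕ) {K D C : ℝ} (hK : 0 ≤ K)
    (hD : 0 ≤ D) (hC : ∀ x, |x| ≤ D * K → |besselJ ℓ x - besselPartial ℓ N x| ≤ C)
    (f : Lp 𝕜 2 (radialMeasure K)) (hf : radialMoments 𝕜 K ℓ.natAbs N f = 0) :
    ‖modalOperator 𝕜 ℓ K D f‖ ≤ C * (D * K / 2) * ‖f‖ := by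
  have hC0 : 0 ≤ C := (abs_nonneg _).trans (hC 0 (by simpa using mul_nonneg hD hK))
  have h1 : ∀ᵐ δ ∂radialMeasure D,
      ‖modalOperator 𝕜 ℓ K D f δ‖ ≤ C * (√(K ^ 2 / 2) * ‖f‖) := by
    filter_upwards [modalOperator_apply ℓ K D f, ae_mem_radialMeasure D] with δ h2 hδ
    rw [h2]
    -- The Taylor polynomial integrates to zero against `f`, so it can be subtracted from the
    -- kernel.
    have h3 : ∫ k, (besselJ ℓ (δ * k) : 𝕜) * f k ∂radialMeasure K =
        ∫ k, ((besselJ ℓ (δ * k) : 𝕜) * f k - (besselPartial ℓ N (δ * k) : 𝕜) * f k)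
          ∂radialMeasure K := by
      rw [integral_sub (integrable_modal ℓ f δ) (integrable_besselPartial_mul ℓ N f δ),
        integral_besselPartial_mul_eq_zero ℓ N f hf, sub_zero]
    rw [h3]
    calc _ ≤ ∫ k, C * ‖f k‖ ∂radialMeasure K := by
          refine norm_integral_le_of_norm_le ((integrable_of_Lp f).norm.const_mul C) ?_
          filter_upwards [ae_mem_radialMeasure K] with k hk
          rw [← sub_mul, ← RCLike.ofReal_sub, norm_mul, RCLike.norm_ofReal]
          refine mul_le_mul_of_nonneg_right (hC _ ?_) (norm_nonneg _)
          rw [abs_of_nonneg (mul_nonneg hδ.1 hk.1)]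
          exact mul_le_mul hδ.2 hk.2 hk.1 hD
      _ ≤ _ := by
          rw [integral_const_mul]
          exact mul_le_mul_of_nonneg_left (integral_norm_le_of_Lp hK f) hC0
  refine (Lp.norm_le_of_ae_bound (by positivity) h1).trans_eq ?_
  have h4 : (measureUnivNNReal (radialMeasure D) : ℝ) ^ (2 : ENNReal).toReal⁻¹ =
      √(D ^ 2 / 2) := by
    have : (measureUnivNNReal (radialMeasure D) : ℝ) = D ^ 2 / 2 := by
      rw [← ENNReal.coe_toReal, coe_measureUnivNNReal, radialMeasure_univ hD,
        ENNReal.toReal_ofReal (by positivity)]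
    rw [this, Real.sqrt_eq_rpow]
    norm_num
  have h5 : √(D ^ 2 / 2) * √(K ^ 2 / 2) = D * K / 2 := by
    rw [← Real.sqrt_mul (by positivity), show D ^ 2 / 2 * (K ^ 2 / 2) = (D * K / 2) ^ 2 by ring,
      Real.sqrt_sq (by positivity)]
  rw [h4, ← h5]
  ring

end

/-! ### Choice of the number of moments. -/

theorem lemma1 {𝕜 : Type*} [RCLike 𝕜] (ℓ : ℤ) (K D W ε : ℝ)
    (hK : 0 < K) (hD : 0 < D) (hW : W = D * K / (2 * Real.pi)) (hε : 0 < ε) :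
    ∃ H : ℕ, epsilonRank (modalOperator 𝕜 ℓ K D) ε = H ∧
      (H : ℝ) ≤ max 0 (max (Real.pi * Real.exp 1 ^ 2 * W - |(ℓ : ℝ)| / 2)
        (Real.log (2 * Real.pi * W / ε) + 3 / 2 - |(ℓ : ℝ)| / 2)) := by
  set M := max 0 (max (Real.pi * Real.exp 1 ^ 2 * W - |(ℓ : ℝ)| / 2)
        (Real.log (2 * Real.pi * W / ε) + 3 / 2 - |(ℓ : ℝ)| / 2)) with hM
  have hM0 : 0 ≤ M := le_max_left _ _
  set N := ⌊M⌋₊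
  set R := D * K with hRdef
  have hR : 0 < R := mul_pos hD hK
  have hWR : 2 * Real.pi * W = R := by
    rw [hW]; field_simp
  have hn : |(ℓ : ℝ)| = (ℓ.natAbs : ℝ) := by rw [Nat.cast_natAbs, Int.cast_abs]
  have hlt : M < N + 1 := Nat.lt_floor_add_one M
  have h1 : Real.pi * Real.exp 1 ^ 2 * W - |(ℓ : ℝ)| / 2 ≤ M :=
    (le_max_left _ _).trans (le_max_right _ _)
  have h2 : Real.log (2 * Real.pi * W / ε) + 3 / 2 - |(ℓ : ℝ)| / 2 ≤ M :=
    (le_max_right _ _).trans (le_max_right _ _)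
  rw [hn] at h1 h2
  have he : Real.exp 1 ^ 2 = Real.exp 2 := by
    rw [← Real.exp_nat_mul]; norm_num
  -- Twice `M < N + 1`; the `+ 2` is the gain from rounding down.
  have hRp : Real.exp 2 * R ≤ (2 * N + ℓ.natAbs : ℕ) + 2 := by
    rw [he] at h1
    rw [← hWR]
    push_cast
    linarith
  have hεp : R * Real.exp (1 / 2 - (2 * N + ℓ.natAbs : ℕ) / 2) ≤ ε := by
    -- The `3 / 2` is 1 for the floor plus the `1 / 2` in the exponent.
    have h3 : Real.log (R / ε) ≤ -(1 / 2 - (2 * N + ℓ.natAbs : ℕ) / 2) := by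
      rw [hWR] at h2
      push_cast
      linarith
    rw [Real.log_le_iff_le_exp (by positivity), Real.exp_neg, div_le_iff₀ hε] at h3
    rwa [← le_div_iff₀ (Real.exp_pos _), div_eq_inv_mul]
  have hrank : epsilonRank (modalOperator 𝕜 ℓ K D) ε ≤ N := by
    refine epsilonRank_le_of_norm_le_on_ker _ hε (radialMoments 𝕜 K ℓ.natAbs N) fun f hf => ?_
    refine (norm_modalOperator_le_of_radialMoments_eq_zero ℓ N hK.le hD.le
      (fun x hx => abs_besselJ_sub_besselPartial_le ℓ N hx hRp) f hf).trans ?_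
    refine mul_le_mul_of_nonneg_right (le_trans ?_ hεp) (norm_nonneg _)
    have := mul_le_mul_of_nonneg_left
      (add_one_mul_exp_neg_le ((2 * N + ℓ.natAbs : ℕ) : ℝ)) hR.le
    linarith
  obtain ⟨H, hH⟩ := Cardinal.lt_aleph0.1 (hrank.trans_lt Cardinal.natCast_lt_aleph0)
  refine ⟨H, hH, ?_⟩
  rw [hH, Nat.cast_le] at hrank
  exact (Nat.cast_le.2 hrank).trans (Nat.floor_le hM0)
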